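/- Let $L$ be an orthomodular lattice, with orthocomplementation $p \mapsto p^\bot$ and Sasaki projection $p \mathbin{\&} q = q \wedge (p \vee q^\bot)$. A graph $\mathfrak G = (A, M)$ over $L$ consists of a set $A$ and a relation $M \subseteq A \times L \times A$, where $M(a,p,b)$ means that measuring $a$ may yield the outcome $p$ and lead to $b$. Say that $a \in A$ verifies $p \in L$, written $a \Vdash p$, if there is no $b \in A$ with $M(a, p^\bot, b)$, and let $[\![a]\!] = \{p \in L \mid a \Vdash p\}$. The graph $\mathfrak G$ is a model of the theory $\mathcal T_L$ if 1. $a \Vdash \top$ for all $a \in A$; 2. $a \Vdash \bot$ for no $a \in A$; 3. for every $p \neq \top$ in $L$ there is $a \in A$ with $a \not\Vdash p$; 4. for all $p \leq q$ in $L$ and $a \in A$, if $a \Vdash p$ then $a \Vdash q$; 5. for all $p, q \in L$ and $a \in A$, if $a \Vdash p$ and $a \Vdash q$ then $a \Vdash p \mathbin{\&} q$; 6. for all $p, q \in L$ and $a, b \in A$, if $a \Vdash p$ and $M(a, q, b)$ then $b \Vdash p \mathbin{\&} q$. For a real or complex Hilbert space $H$, let $L(H)$ be the orthomodular lattice of the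 closed subspaces of $H$, with the orthogonal complement. A vector ray is a subspace spanned by one nonzero vector. Corollary. Let $H$ be a real or complex Hilbert space (possibly infinite-dimensional) with $\dim H \geq 3$, and let $\mathfrak G = (A, M)$ be a model of $\mathcal T_{L(H)}$. Then for every $a \in A$, the set $[\![a]\!]$ contains at most one vector ray. Hence there is no $a \in A$ that verifies two distinct atoms of $L(H)$. Consequently there is no Bell-type hidden-variable model for two spin one-half particles: there are no model $\mathfrak B = (\Lambda, M)$ of $\mathcal T_{L(\mathbb C^2 \otimes \mathbb C^2)}$ and functions $\alpha, \beta$, assigning to each unit vector of $\mathbb R^3$ and each $\lambda \in \Lambda$ a value in $\{+1, -1\}$, such that for all $\lambda \in \Lambda$ and all unit vectors $m, n \in \mathbb R^3$, $\lambda$ verifies $E_m(\alpha(m, \lambda)) \otimes E_n(\beta(n, \lambda))$. Here $E_n(\varepsilon) \subseteq \mathbb C^2$ is the eigenspace for the eigenvalue $\varepsilon$ of the spin observable $n_1\sigma_x + n_2\sigma_y + n_3\sigma_z$, where $\sigma_x, \sigma_y, \sigma_z$ are the Pauli matrices. -/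

import Mathlib

open scoped TensorProduct

/-- An orthomodular lattice: a bounded lattice with an antitone involutive complementation `pᶜ`
(written `p^⊥` in mathematics) satisfying the orthomodular law. -/
class OrthomodularLattice (L : Type*) [Lattice L] [BoundedOrder L] extends Compl L where
  compl_antitone : ∀ p q : L, p ≤ q → qᶜ ≤ pᶜ
  compl_compl : ∀ p : L, pᶜᶜ = p
  inf_compl : ∀ p : L, p ⊓ pᶜ = ⊥
  sup_compl : ∀ p : L, p ⊔ pᶜ = ⊤
  orthomodular : ∀ p q : L, p ≤ q → p ⊔ (q ⊓ pᶜ) = q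

/-- The Sasaki projection `p & q = q ∧ (p ∨ q^⊥)`. -/
def sasaki {L : Type*} [Lattice L] [BoundedOrder L] [OrthomodularLattice L] (p q : L) : L :=
  q ⊓ (p ⊔ qᶜ)

/-- A graph `(A, M)` with universe `A` and arrows labelled by elements of `L`. The relation
`Mes a p b` says that measuring `a` may yield the outcome `p` and lead to `b`. -/
structure MeasurementGraph (L : Type*) (A : Type*) where
  Mes : A → L → A → Prop

namespace MeasurementGraph

variable {L A : Type*} [Lattice L] [BoundedOrder L] [OrthomodularLattice L]

/-- `a` verifies `p`: the outcome `p^⊥` cannot be obtained by measuring `a`. -/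
def Verifies (G : MeasurementGraph L A) (a : A) (p : L) : Prop :=
  ¬ ∃ b, G.Mes a pᶜ b

/-- The set of the properties verified by `a`. -/
def properties (G : MeasurementGraph L A) (a : A) : Set L :=
  {p | G.Verifies a p}

/-- `G` is a model of the theory `T_L`, that is, it satisfies all the axioms of `T_L`. -/
structure IsModel (G : MeasurementGraph L A) : Prop where
  verifies_top : ∀ a, G.Verifies a ⊤
  not_verifies_bot : ∀ a, ¬ G.Verifies a ⊥
  exists_not_verifies : ∀ p : L, p ≠ ⊤ → ∃ a, ¬ G.Verifies a p
  verifies_mono : ∀ p q : L, p ≤ q → ∀ a, G.Verifies a p → G.Verifies a q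
  verifies_sasaki : ∀ p q : L, ∀ a, G.Verifies a p → G.Verifies a q → G.Verifies a (sasaki p q)
  preservation : ∀ p q : L, ∀ a b, G.Verifies a p → G.Mes a q b → G.Verifies b (sasaki p q)

end MeasurementGraph

/-- The Hilbert lattice `L(H)` of the closed subspaces of `H`, ordered by inclusion. Meets are
intersections and joins are closures of sums. -/
abbrev HilbertLattice (𝕜 H : Type*) [RCLike 𝕜] [NormedAddCommGroup H] [InnerProductSpace 𝕜 H] :
    Type _ :=
  ClosedSubmodule 𝕜 H

/-- With the orthogonal complement, the lattice `L(H)` of a Hilbert space `H` is orthomodular. -/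
instance HilbertLattice.instOrthomodularLattice {𝕜 H : Type*} [RCLike 𝕜] [NormedAddCommGroup H]
    [InnerProductSpace 𝕜 H] [CompleteSpace H] : OrthomodularLattice (HilbertLattice 𝕜 H) where
  compl p := p.orthogonal
  compl_antitone _ _ h := ClosedSubmodule.orthogonal_le h
  compl_compl p := p.orthogonal_orthogonal_eq
  inf_compl p := p.inf_orthogonal_eq_bot
  sup_compl p := by
    have h := ClosedSubmodule.sup_orthogonal p.orthogonal p
    rw [p.orthogonal_orthogonal_eq, inf_comm, p.inf_orthogonal_eq_bot,
      ClosedSubmodule.bot_orthogonal_eq_top] at h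
    exact h
  orthomodular p q hpq := by
    refine le_antisymm (sup_le hpq inf_le_left) fun x hx => ?_
    obtain ⟨y, hy, hz⟩ :=
      Submodule.HasOrthogonalProjection.exists_orthogonal (K := p.toSubmodule) x
    have hyp : y ∈ p := hy
    have hzq : x - y ∈ q := q.toSubmodule.sub_mem hx (hpq hyp)
    have h1 : y ∈ p ⊔ (q ⊓ p.orthogonal) := (le_sup_left : p ≤ _) hyp
    have h2 : x - y ∈ p ⊔ (q ⊓ p.orthogonal) :=
      (le_sup_right : q ⊓ p.orthogonal ≤ _) ⟨hzq, hz⟩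
    have h3 := (p ⊔ (q ⊓ p.orthogonal)).toSubmodule.add_mem h1 h2
    rwa [add_sub_cancel] at h3

/-- A closed subspace is a vector ray if it is spanned by a nonzero vector. -/
def IsVectorRay {𝕜 H : Type*} [RCLike 𝕜] [NormedAddCommGroup H] [InnerProductSpace 𝕜 H]
    (p : HilbertLattice 𝕜 H) : Prop :=
  ∃ u : H, u ≠ 0 ∧ p.toSubmodule = Submodule.span 𝕜 {u}

/-- The state space `ℂ²` of a spin one-half particle. -/
abbrev Spin : Type := EuclideanSpace ℂ (Fin 2)

/-- The state space `ℂ² ⊗ ℂ²` of a pair of spin one-half particles. -/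
abbrev SpinPair : Type := Spin ⊗[ℂ] Spin

instance SpinPair.instCompleteSpace : CompleteSpace SpinPair :=
  FiniteDimensional.complete ℂ SpinPair

/-- A direction in space: a unit vector of `ℝ³`. -/
abbrev Direction : Type := Metric.sphere (0 : EuclideanSpace ℝ (Fin 3)) 1

/-- The spin observable `n₁ σ_x + n₂ σ_y + n₃ σ_z` along the direction `n`. -/
noncomputable def spinObservable (n : Direction) : Spin →ₗ[ℂ] Spin :=
  Matrix.toEuclideanLin
    !![(n.1 2 : ℂ), (n.1 0 : ℂ) - Complex.I * (n.1 1 : ℂ);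
       (n.1 0 : ℂ) + Complex.I * (n.1 1 : ℂ), -(n.1 2 : ℂ)]

/-- The eigenspace of the spin observable along `n` for the outcome `ε = ±1`. -/
noncomputable def spinEigenspace (n : Direction) (ε : ℤˣ) : Submodule ℂ Spin :=
  Module.End.eigenspace (spinObservable n) ((ε : ℤ) : ℂ)

/-- The subspace `[α] ⊗ [β]` of `ℂ² ⊗ ℂ²` for the joint outcome: `α` for the spin of the first
particle along `m`, and `β` for the spin of the second particle along `n`. -/
noncomputable def jointOutcome (m n : Direction) (α β : ℤˣ) : HilbertLattice ℂ SpinPair where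
  toSubmodule := Submodule.map₂ (TensorProduct.mk ℂ Spin Spin)
    (spinEigenspace m α) (spinEigenspace n β)
  isClosed' := Submodule.closed_of_finiteDimensional _

/-- A Bell-type hidden-variable model: a model of `T_{L(ℂ² ⊗ ℂ²)}` whose elements `l` determine
the outcomes `α m l` and `β n l` of the spin measurements of the two particles, in all the
directions `m` and `n`, in the sense that `l` verifies the corresponding joint outcome. -/
structure IsBellModel {A : Type*} (G : MeasurementGraph (HilbertLattice ℂ SpinPair) A)
    (α β : Direction → A → ℤˣ) : Prop where
  isModel : G.IsModel
  verifies_joint : ∀ (l : A) (m n : Direction),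
    G.Verifies l (jointOutcome m n (α m l) (β n l))

/-! Verified rays breed further verified rays. If `a` verifies the rays of `u` and `v`, then by
monotonicity it verifies the planes spanned by `u, w` and by `v, w`, hence their Sasaki projection.
This lies in the ray of `w` when the components of `u` and `v` orthogonal to `w` are orthogonal to
each other (`sasaki_finiteSpan_pair_le`). Such `w` form a quadratic cone, on which a third dimension
gives room to move. In the frame of the bisectors of `u` and `v`, the rays are `(c, ±s, 0)` with `c
≥ s`. If `c² ≤ 2s²`, the cone contains two orthogonal rays, whose Sasaki projection is `⊥`: a
contradiction. Otherwise it contains a pair with `c² / s²` lowered by one, and the descent ends in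
the first case (`not_verifies_frameVector`). For two spins, the outcomes along `z, z` and along `x,
x` would give two distinct verified rays. -/

/-- The closed subspace spanned by finitely many vectors. -/
def finiteSpan (𝕜 : Type*) {H : Type*} [RCLike 𝕜] [NormedAddCommGroup H] [InnerProductSpace 𝕜 H]
    (s : Set H) [hs : Finite s] : HilbertLattice 𝕜 H where
  toSubmodule := Submodule.span 𝕜 s
  isClosed' :=
    haveI := FiniteDimensional.span_of_finite 𝕜 (Set.toFinite s)
    Submodule.closed_of_finiteDimensional _

/-! ### Rays, Sasaki projections and frames in `L(H)`. -/

section HilbertLattice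

variable {𝕜 H : Type*} [RCLike 𝕜] [NormedAddCommGroup H] [InnerProductSpace 𝕜 H]

theorem finiteSpan_mono {s t : Set H} [Finite s] [Finite t] (h : s ⊆ t) :
    finiteSpan 𝕜 s ≤ finiteSpan 𝕜 t :=
  Submodule.span_mono (R := 𝕜) h

theorem mem_finiteSpan_singleton {u x : H} : x ∈ finiteSpan 𝕜 {u} ↔ ∃ c : 𝕜, c • u = x :=
  Submodule.mem_span_singleton

theorem mem_finiteSpan_pair {u v x : H} :
    x ∈ finiteSpan 𝕜 {u, v} ↔ ∃ c d : 𝕜, c • u + d • v = x :=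
  Submodule.mem_span_pair

theorem isVectorRay_iff_exists_finiteSpan {p : HilbertLattice 𝕜 H} :
    IsVectorRay p ↔ ∃ u : H, u ≠ 0 ∧ p = finiteSpan 𝕜 {u} :=
  exists_congr fun _ => and_congr_right fun _ =>
    ClosedSubmodule.toSubmodule_injective.eq_iff (b := finiteSpan 𝕜 _)

theorem finiteSpan_singleton_smul {c : 𝕜} (hc : c ≠ 0) (u : H) :
    finiteSpan 𝕜 {c • u} = finiteSpan 𝕜 {u} :=
  ClosedSubmodule.toSubmodule_injective
    (Submodule.span_singleton_smul_eq (IsUnit.mk0 c hc) u)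

theorem isVectorRay_of_isAtom {p : HilbertLattice 𝕜 H} (hp : IsAtom p) : IsVectorRay p := by
  have hne : p.toSubmodule ≠ ⊥ := fun h => hp.1 (ClosedSubmodule.toSubmodule_injective h)
  obtain ⟨u, hu, hu0⟩ := Submodule.exists_mem_ne_zero_of_ne_bot hne
  refine isVectorRay_iff_exists_finiteSpan.2 ⟨u, hu0, ?_⟩
  have hle : finiteSpan 𝕜 {u} ≤ p :=
    (Submodule.span_singleton_le_iff_mem u p.toSubmodule).2 hu
  rcases hp.le_iff.1 hle with h | h
  · exact absurd (show u ∈ (⊥ : HilbertLattice 𝕜 H) from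
      h ▸ Submodule.mem_span_singleton_self u) hu0
  · exact h.symm

/-- If the components of `u` and `v` orthogonal to `w` are orthogonal to each other, then the
Sasaki projection of the span of `u, w` onto the span of `v, w` is contained in the ray of `w`. -/
theorem sasaki_finiteSpan_pair_le [CompleteSpace H] {u v w : H} (hw : w ≠ 0)
    (h : inner 𝕜 v w * inner 𝕜 w u = inner 𝕜 w w * inner 𝕜 v u) :
    sasaki (finiteSpan 𝕜 {u, w}) (finiteSpan 𝕜 {v, w}) ≤ finiteSpan 𝕜 {w} := by
  have hww : inner 𝕜 w w ≠ 0 := inner_self_ne_zero.2 hw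
  -- Up to the factor `⟪w, w⟫`, this is the component of `v` orthogonal to `w`; it may vanish.
  set v' : H := inner 𝕜 w w • v - inner 𝕜 w v • w with hv'
  have hreal : (starRingEnd 𝕜) (inner 𝕜 w w) = inner 𝕜 w w := inner_conj_symm w w
  have hw' : inner 𝕜 v' w = 0 := by
    simp only [hv', inner_sub_left, inner_smul_left, hreal, inner_conj_symm]
    ring
  have hu' : inner 𝕜 v' u = 0 := by
    simp only [hv', inner_sub_left, inner_smul_left, hreal, inner_conj_symm]
    rw [h]; ring
  have hmem : v' ∈ finiteSpan 𝕜 {v, w} :=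
    mem_finiteSpan_pair.2 ⟨inner 𝕜 w w, -inner 𝕜 w v, by rw [hv', neg_smul, sub_eq_add_neg]⟩
  -- Both summands are orthogonal to `v'`: the first by `h`, the second because `v'` lies in the
  -- span of `v, w`.
  have hle : finiteSpan 𝕜 {u, w} ⊔ (finiteSpan 𝕜 {v, w})ᗮ ≤ (finiteSpan 𝕜 {v'})ᗮ := by
    refine sup_le (fun x hx => ?_) (ClosedSubmodule.orthogonal_le ?_)
    · obtain ⟨c, d, rfl⟩ := mem_finiteSpan_pair.1 hx
      refine Submodule.mem_orthogonal_singleton_iff_inner_right.2 ?_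
      simp [inner_add_right, inner_smul_right, hw', hu']
    · exact (Submodule.span_singleton_le_iff_mem _ _).2 hmem
  rintro x ⟨hx, hx'⟩
  obtain ⟨c, d, rfl⟩ := mem_finiteSpan_pair.1 hx
  have h0 : inner 𝕜 v' (c • v + d • w) = 0 :=
    Submodule.mem_orthogonal_singleton_iff_inner_right.1 (hle hx')
  have hcv : inner 𝕜 w w • (c • v) = c • v' + (c * inner 𝕜 w v) • w := by
    rw [hv', smul_sub, smul_smul, smul_smul, smul_smul, mul_comm]; abel
  have h1 : c * inner 𝕜 v' v' = 0 := by
    rw [inner_add_right, inner_smul_right, inner_smul_right, hw', mul_zero, add_zero] at h0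
    have : inner 𝕜 v' v' = inner 𝕜 w w * inner 𝕜 v' v := by
      conv_lhs => rw [hv', inner_sub_right, inner_smul_right, inner_smul_right, ← hv', hw']
      ring
    rw [this, mul_left_comm, h0, mul_zero]
  have h2 : c • v' = 0 := by
    rcases mul_eq_zero.1 h1 with h | h
    · rw [h, zero_smul]
    · rw [inner_self_eq_zero.1 h, smul_zero]
  rw [h2, zero_add] at hcv
  refine mem_finiteSpan_singleton.2 ⟨(inner 𝕜 w w)⁻¹ * (c * inner 𝕜 w v) + d, ?_⟩
  rw [add_smul, mul_smul, ← hcv, inv_smul_smul₀ hww]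

theorem sasaki_finiteSpan_singleton_eq_bot [CompleteSpace H] {u v : H} (h : inner 𝕜 v u = 0) :
    sasaki (finiteSpan 𝕜 {u}) (finiteSpan 𝕜 {v}) = ⊥ := by
  have hle : finiteSpan 𝕜 {u} ⊔ (finiteSpan 𝕜 {v})ᗮ ≤ (finiteSpan 𝕜 {v})ᗮ :=
    sup_le ((Submodule.span_singleton_le_iff_mem _ _).2
      (Submodule.mem_orthogonal_singleton_iff_inner_right.2 h)) le_rfl
  refine le_bot_iff.1 ?_
  rw [← (finiteSpan 𝕜 {v}).inf_orthogonal_eq_bot]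
  exact inf_le_inf_left _ hle

theorem exists_norm_eq_one_and_orthogonal_pair (hH : 3 ≤ Module.rank 𝕜 H) (u v : H) :
    ∃ e : H, ‖e‖ = 1 ∧ inner 𝕜 u e = 0 ∧ inner 𝕜 v e = 0 := by
  classical
  have hfin : FiniteDimensional 𝕜 (Submodule.span 𝕜 {u, v}) :=
    FiniteDimensional.span_of_finite 𝕜 (Set.toFinite _)
  have hne : Submodule.span 𝕜 {u, v} ≠ ⊤ := by
    intro htop
    have h1 := rank_span_finset_le (R := 𝕜) ({u, v} : Finset H)
    rw [Finset.coe_pair, htop, rank_top] at h1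
    have h2 : (3 : Cardinal) ≤ ((({u, v} : Finset H).card : ℕ) : Cardinal) := hH.trans h1
    have h3 : 3 ≤ ({u, v} : Finset H).card := by exact_mod_cast h2
    have := Finset.card_le_two (a := u) (b := v)
    omega
  obtain ⟨x, hx, hx0⟩ := Submodule.exists_mem_ne_zero_of_ne_bot
    (mt Submodule.orthogonal_eq_bot_iff.1 hne)
  refine ⟨((‖x‖ : 𝕜)⁻¹) • x, norm_smul_inv_norm hx0, ?_, ?_⟩
  · rw [inner_smul_right, hx u (Submodule.subset_span (by simp)), mul_zero]
  · rw [inner_smul_right, hx v (Submodule.subset_span (by simp)), mul_zero]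

/-- The vector with real coordinates `x, y, z` in a frame. -/
def frameVector (𝕜 : Type*) {H : Type*} [RCLike 𝕜] [NormedAddCommGroup H]
    [InnerProductSpace 𝕜 H] (e : Fin 3 → H) (x y z : ℝ) : H :=
  (x : 𝕜) • e 0 + (y : 𝕜) • e 1 + (z : 𝕜) • e 2

theorem inner_frameVector {e : Fin 3 → H} (he : Orthonormal 𝕜 e) (x y z x' y' z' : ℝ) :
    inner 𝕜 (frameVector 𝕜 e x y z) (frameVector 𝕜 e x' y' z') =
      ((x * x' + y * y' + z * z' : ℝ) : 𝕜) := by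
  have h := orthonormal_iff_ite.1 he
  simp only [frameVector, inner_add_left, inner_add_right, inner_smul_left, inner_smul_right, h,
    RCLike.conj_ofReal]
  simp
  ring

end HilbertLattice

/-! ### Propagation of verified rays in a model. -/

namespace MeasurementGraph.IsModel

variable {𝕜 H A : Type*} [RCLike 𝕜] [NormedAddCommGroup H] [InnerProductSpace 𝕜 H]
  [CompleteSpace H] {G : MeasurementGraph (HilbertLattice 𝕜 H) A}

theorem inner_ne_zero_of_verifies (hG : G.IsModel) {a : A} {u v : H}
    (hu : G.Verifies a (finiteSpan 𝕜 {u})) (hv : G.Verifies a (finiteSpan 𝕜 {v})) :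
    inner 𝕜 v u ≠ 0 := fun h =>
  hG.not_verifies_bot a (sasaki_finiteSpan_singleton_eq_bot h ▸ hG.verifies_sasaki _ _ a hu hv)

theorem verifies_finiteSpan_singleton (hG : G.IsModel) {a : A} {u v w : H}
    (hu : G.Verifies a (finiteSpan 𝕜 {u})) (hv : G.Verifies a (finiteSpan 𝕜 {v})) (hw : w ≠ 0)
    (h : inner 𝕜 v w * inner 𝕜 w u = inner 𝕜 w w * inner 𝕜 v u) :
    G.Verifies a (finiteSpan 𝕜 {w}) :=
  hG.verifies_mono _ _ (sasaki_finiteSpan_pair_le hw h) a <| hG.verifies_sasaki _ _ a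
    (hG.verifies_mono _ _ (finiteSpan_mono (by simp)) a hu)
    (hG.verifies_mono _ _ (finiteSpan_mono (by simp)) a hv)

/-- The equation is `(cx - sy)(cx + sy) = (x² + y² + z²)(c² - s²)`, the condition of
`verifies_finiteSpan_singleton` in coordinates. -/
theorem verifies_frameVector (hG : G.IsModel) {a : A} {e : Fin 3 → H} (he : Orthonormal 𝕜 e)
    {c s x y z : ℝ}
    (hu : G.Verifies a (finiteSpan 𝕜 {frameVector 𝕜 e c s 0}))
    (hv : G.Verifies a (finiteSpan 𝕜 {frameVector 𝕜 e c (-s) 0}))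
    (hz : z ≠ 0) (h : s ^ 2 * x ^ 2 - c ^ 2 * y ^ 2 = (c ^ 2 - s ^ 2) * z ^ 2) :
    G.Verifies a (finiteSpan 𝕜 {frameVector 𝕜 e x y z}) := by
  refine hG.verifies_finiteSpan_singleton hu hv ?_ ?_
  · intro h0
    have := inner_frameVector he x y z x y z
    rw [h0, inner_zero_left, eq_comm, RCLike.ofReal_eq_zero] at this
    have : 0 < z ^ 2 := by positivity
    nlinarith [sq_nonneg x, sq_nonneg y]
  · simp only [inner_frameVector he, ← RCLike.ofReal_mul]
    congr 1
    linear_combination h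

/-- Two rays with half-angle cotangent `c / s ≥ 1` are not both verified. The induction replaces
them with two rays whose squared cotangent is smaller by one. -/
theorem not_verifies_frameVector (hG : G.IsModel) {a : A} {s : ℝ} (hs : 0 < s) (n : ℕ) :
    ∀ {e : Fin 3 → H} {c : ℝ}, Orthonormal 𝕜 e → s ≤ c → c ^ 2 ≤ (n + 2) * s ^ 2 →
      G.Verifies a (finiteSpan 𝕜 {frameVector 𝕜 e c s 0}) →
      ¬ G.Verifies a (finiteSpan 𝕜 {frameVector 𝕜 e c (-s) 0}) := by
  induction n with
  | zero =>
    intro e c he hsc hc hu hv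
    have hsc2 : s ^ 2 ≤ c ^ 2 := by gcongr
    have hs2 : 0 < s ^ 2 := by positivity
    norm_num at hc
    -- The point of the cone with `x² + y² = z²`, so that `(x, y, z)` and `(x, y, -z)` are
    -- orthogonal. A real `y` needs `c² ≤ 2s²`.
    set x := √(2 * c ^ 2 - s ^ 2)
    set y := √(2 * s ^ 2 - c ^ 2)
    set z := √(c ^ 2 + s ^ 2)
    have hx : x ^ 2 = 2 * c ^ 2 - s ^ 2 := Real.sq_sqrt (by linarith)
    have hy : y ^ 2 = 2 * s ^ 2 - c ^ 2 := Real.sq_sqrt (by linarith)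
    have hz : z ^ 2 = c ^ 2 + s ^ 2 := Real.sq_sqrt (by linarith)
    have hz0 : z ≠ 0 := by rintro h; rw [h] at hz; nlinarith
    refine hG.inner_ne_zero_of_verifies
      (hG.verifies_frameVector he (x := x) (y := y) (z := z) hu hv hz0 ?_)
      (hG.verifies_frameVector he (x := x) (y := y) (z := -z) hu hv (neg_ne_zero.2 hz0) ?_) ?_
    · rw [hx, hy, hz]; ring
    · rw [neg_sq, hx, hy, hz]; ring
    · rw [inner_frameVector he, RCLike.ofReal_eq_zero]
      linear_combination hx + hy - hz
  | succ n ih =>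
    intro e c he hsc hc hu hv
    have hsc2 : s ^ 2 ≤ c ^ 2 := by gcongr
    by_cases hcs : c ^ 2 ≤ 2 * s ^ 2
    · exact ih he hsc (by nlinarith [sq_nonneg s, (n.cast_nonneg : (0 : ℝ) ≤ n)]) hu hv
    -- The points `(x, 0, ±s)` of the cone. Swapping the last two axes of the frame puts them in the
    -- form `(x, ±s, 0)`.
    set x := √(c ^ 2 - s ^ 2)
    have hx : x ^ 2 = c ^ 2 - s ^ 2 := Real.sq_sqrt (by linarith)
    have key : ∀ t : ℝ, frameVector 𝕜 (e ∘ Equiv.swap 1 2) x t 0 = frameVector 𝕜 e x 0 t := by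
      intro t
      have h0 : Equiv.swap (1 : Fin 3) 2 0 = 0 := by decide
      simp [frameVector, h0]
    refine ih (e := e ∘ Equiv.swap 1 2) (c := x) (he.comp _ (Equiv.injective _))
      (Real.le_sqrt_of_sq_le (by linarith)) ?_ ?_ ?_
    · rw [hx]; push_cast at hc; linarith
    · rw [key]
      exact hG.verifies_frameVector he hu hv hs.ne' (by rw [hx]; ring)
    · rw [key]
      exact hG.verifies_frameVector he hu hv (neg_ne_zero.2 hs.ne') (by rw [hx]; ring)

theorem finiteSpan_eq_of_verifies (hG : G.IsModel) (hH : 3 ≤ Module.rank 𝕜 H) {a : A} {u v : H}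
    (hu : ‖u‖ = 1) (hv : ‖v‖ = 1) {r : ℝ} (hr : 0 ≤ r) (huv : inner 𝕜 u v = (r : 𝕜))
    (hau : G.Verifies a (finiteSpan 𝕜 {u})) (hav : G.Verifies a (finiteSpan 𝕜 {v})) :
    u = v := by
  by_contra hne
  have hvu : inner 𝕜 v u = (r : 𝕜) := by
    rw [← inner_conj_symm, huv, RCLike.conj_ofReal]
  have huu : inner 𝕜 u u = 1 := by rw [inner_self_eq_norm_sq_to_K, hu]; simp
  have hvv : inner 𝕜 v v = 1 := by rw [inner_self_eq_norm_sq_to_K, hv]; simp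
  have hadd : ‖u + v‖ ^ 2 = 2 + 2 * r := by
    rw [norm_add_sq (𝕜 := 𝕜), hu, hv, huv, RCLike.ofReal_re]; ring
  have hsub : ‖u - v‖ ^ 2 = 2 - 2 * r := by
    rw [norm_sub_sq (𝕜 := 𝕜), hu, hv, huv, RCLike.ofReal_re]; ring
  have hs : 0 < ‖u - v‖ := norm_pos_iff.2 (sub_ne_zero.2 hne)
  have hsc : ‖u - v‖ ≤ ‖u + v‖ := by
    refine le_of_sq_le_sq ?_ (norm_nonneg _)
    linarith
  have hc : 0 < ‖u + v‖ := hs.trans_le hsc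
  obtain ⟨f, hf, hfu, hfv⟩ := exists_norm_eq_one_and_orthogonal_pair hH u v
  -- The bisectors `u + v` and `u - v` are orthogonal since `u, v` are unit vectors with real inner
  -- product.
  set e : Fin 3 → H := ![((‖u + v‖ : 𝕜)⁻¹) • (u + v), ((‖u - v‖ : 𝕜)⁻¹) • (u - v), f] with he
  have heo : Orthonormal 𝕜 e := by
    have h01 : inner 𝕜 (u + v) (u - v) = 0 := by
      simp only [inner_add_left, inner_sub_right, huu, hvv, huv, hvu]; ring
    refine ⟨fun i => ?_, fun i j hij => ?_⟩
    · fin_cases i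
      · exact norm_smul_inv_norm (norm_pos_iff.1 hc)
      · exact norm_smul_inv_norm (norm_pos_iff.1 hs)
      · exact hf
    · have h02 : inner 𝕜 (u + v) f = 0 := by rw [inner_add_left, hfu, hfv, add_zero]
      have h12 : inner 𝕜 (u - v) f = 0 := by rw [inner_sub_left, hfu, hfv, sub_zero]
      have h10 := inner_eq_zero_symm.1 h01
      have h20 := inner_eq_zero_symm.1 h02
      have h21 := inner_eq_zero_symm.1 h12
      fin_cases i <;> fin_cases j <;> first
        | exact absurd rfl hij
        | simp only [he, Fin.zero_eta, Fin.mk_one, Fin.reduceFinMk, Matrix.cons_val,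
            inner_smul_left, inner_smul_right, h01, h02, h10, h12, h20, h21, mul_zero]
  have hc' : (‖u + v‖ : 𝕜) ≠ 0 := by exact_mod_cast hc.ne'
  have hs' : (‖u - v‖ : 𝕜) ≠ 0 := by exact_mod_cast hs.ne'
  have h1 : frameVector 𝕜 e ‖u + v‖ ‖u - v‖ 0 = (2 : 𝕜) • u := by
    simp only [frameVector, he, Matrix.cons_val, smul_inv_smul₀ hc', smul_inv_smul₀ hs',
      RCLike.ofReal_zero, zero_smul, two_smul]
    abel
  have h2 : frameVector 𝕜 e ‖u + v‖ (-‖u - v‖) 0 = (2 : 𝕜) • v := by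
    simp only [frameVector, he, Matrix.cons_val, smul_inv_smul₀ hc', smul_inv_smul₀ hs',
      RCLike.ofReal_zero, zero_smul, two_smul, RCLike.ofReal_neg, neg_smul]
    abel
  -- A bound on the squared cotangent, hence on the length of the descent.
  obtain ⟨n, hn⟩ := exists_nat_ge (‖u + v‖ ^ 2 / ‖u - v‖ ^ 2)
  refine hG.not_verifies_frameVector hs n heo hsc ?_ (a := a) ?_ ?_
  · rw [div_le_iff₀ (by positivity)] at hn
    nlinarith [sq_nonneg ‖u - v‖]
  · rwa [h1, finiteSpan_singleton_smul two_ne_zero]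
  · rwa [h2, finiteSpan_singleton_smul two_ne_zero]

theorem subsingleton_isVectorRay (hG : G.IsModel) (hH : 3 ≤ Module.rank 𝕜 H) (a : A) :
    {p ∈ G.properties a | IsVectorRay p}.Subsingleton := by
  rintro p ⟨hp, hpr⟩ q ⟨hq, hqr⟩
  obtain ⟨u, hu0, rfl⟩ := isVectorRay_iff_exists_finiteSpan.1 hpr
  obtain ⟨v, hv0, rfl⟩ := isVectorRay_iff_exists_finiteSpan.1 hqr
  have hq0 : inner 𝕜 u v ≠ 0 := hG.inner_ne_zero_of_verifies hq hp
  set c : 𝕜 := (‖u‖ : 𝕜)⁻¹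
  -- The phase makes the inner product of the normalized vectors real and positive without changing
  -- the ray.
  set d : 𝕜 := (‖v‖ : 𝕜)⁻¹ * ((starRingEnd 𝕜) (inner 𝕜 u v) / (‖inner 𝕜 u v‖ : 𝕜))
  have hu' : (‖u‖ : 𝕜) ≠ 0 := by simpa using hu0
  have hv' : (‖v‖ : 𝕜) ≠ 0 := by simpa using hv0
  have hn' : (‖inner 𝕜 u v‖ : 𝕜) ≠ 0 := by simpa using hq0
  have hc : c ≠ 0 := inv_ne_zero hu'
  have hd : d ≠ 0 := mul_ne_zero (inv_ne_zero hv')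
    (div_ne_zero ((map_ne_zero _).2 hq0) hn')
  rw [← finiteSpan_singleton_smul hc u, ← finiteSpan_singleton_smul hd v] at *
  congr 2
  refine hG.finiteSpan_eq_of_verifies hH (norm_smul_inv_norm hu0) ?_
    (r := ‖u‖⁻¹ * ‖v‖⁻¹ * ‖inner 𝕜 u v‖) (by positivity) ?_ hp hq
  · have hv1 : ‖v‖ ≠ 0 := norm_ne_zero_iff.2 hv0
    have hn1 : ‖inner 𝕜 u v‖ ≠ 0 := norm_ne_zero_iff.2 hq0
    simp only [d, norm_smul, norm_mul, norm_div, norm_inv, RCLike.norm_conj, RCLike.norm_ofReal,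
      abs_norm]
    field_simp
  · simp only [inner_smul_left, inner_smul_right, c, d, map_inv₀, RCLike.conj_ofReal,
      RCLike.ofReal_mul]
    field_simp
    exact RCLike.conj_mul _

end MeasurementGraph.IsModel

/-! ### Two spin one-half particles. -/

/-- The direction of the third coordinate axis. -/
noncomputable def zDirection : Direction :=
  ⟨EuclideanSpace.single 2 1, by simp⟩

/-- The direction of the first coordinate axis. -/
noncomputable def xDirection : Direction :=
  ⟨EuclideanSpace.single 0 1, by simp⟩

/-- Inclusions in rays suffice here and below, since verification is monotone. -/
theorem spinEigenspace_zDirection_le (ε : ℤˣ) :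
    ∃ i : Fin 2, spinEigenspace zDirection ε ≤ Submodule.span ℂ {EuclideanSpace.single i 1} := by
  rcases Int.units_eq_one_or ε with rfl | rfl
  · refine ⟨0, fun v hv => Submodule.mem_span_singleton.2 ⟨v 0, ?_⟩⟩
    have h := Module.End.mem_eigenspace_iff.1 hv
    have h1 := congrArg (fun w : Spin => w 1) h
    simp [spinObservable, zDirection, Matrix.toLpLin_apply, dotProduct,
      Fin.sum_univ_two] at h1
    have h2 : v 1 = 0 := by linear_combination (-1 / 2) * h1
    ext i; fin_cases i <;> simp [h2]
  · refine ⟨1, fun v hv => Submodule.mem_span_singleton.2 ⟨v 1, ?_⟩⟩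
    have h := Module.End.mem_eigenspace_iff.1 hv
    have h1 := congrArg (fun w : Spin => w 0) h
    simp [spinObservable, zDirection, Matrix.toLpLin_apply, dotProduct,
      Fin.sum_univ_two] at h1
    have h2 : v 0 = 0 := by linear_combination (1 / 2) * h1
    ext i; fin_cases i <;> simp [h2]

theorem spinEigenspace_xDirection_le (ε : ℤˣ) :
    spinEigenspace xDirection ε ≤ Submodule.span ℂ {!₂[(1 : ℂ), ((ε : ℤ) : ℂ)]} := by
  refine fun v hv => Submodule.mem_span_singleton.2 ⟨v 0, ?_⟩
  have h := Module.End.mem_eigenspace_iff.1 hv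
  have h1 := congrArg (fun w : Spin => w 0) h
  simp [spinObservable, xDirection, Matrix.toLpLin_apply, dotProduct,
    Fin.sum_univ_two] at h1
  ext i; fin_cases i <;> simp [h1, mul_comm]

theorem jointOutcome_le {m n : Direction} {α β : ℤˣ} {u v : Spin}
    (hu : spinEigenspace m α ≤ Submodule.span ℂ {u})
    (hv : spinEigenspace n β ≤ Submodule.span ℂ {v}) :
    jointOutcome m n α β ≤ finiteSpan ℂ {u ⊗ₜ[ℂ] v} := by
  have h := Submodule.map₂_le_map₂ (f := TensorProduct.mk ℂ Spin Spin) hu hv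
  rw [Submodule.map₂_span_span, Set.image2_singleton] at h
  exact h

theorem three_le_rank_spinPair : 3 ≤ Module.rank ℂ SpinPair := by
  rw [← Module.finrank_eq_rank, Module.finrank_tensorProduct, finrank_euclideanSpace_fin]
  norm_num

theorem not_isBellModel {A : Type*} (G : MeasurementGraph (HilbertLattice ℂ SpinPair) A)
    (α β : Direction → A → ℤˣ) : ¬ IsBellModel G α β := by
  intro hB
  have hG := hB.isModel
  -- The third axiom at `⊥ ≠ ⊤` provides a hidden state.
  obtain ⟨l, -⟩ := hG.exists_not_verifies ⊥ fun h => by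
    have h3 := three_le_rank_spinPair
    have : (⊥ : Submodule ℂ SpinPair) = ⊤ := congrArg ClosedSubmodule.toSubmodule h
    rw [← rank_top, ← this, rank_bot] at h3
    exact absurd h3 (by norm_num)
  obtain ⟨i, hi⟩ := spinEigenspace_zDirection_le (α zDirection l)
  obtain ⟨j, hj⟩ := spinEigenspace_zDirection_le (β zDirection l)
  have h1 := hG.verifies_mono _ _ (jointOutcome_le hi hj) l
    (hB.verifies_joint l zDirection zDirection)
  have h2 := hG.verifies_mono _ _
    (jointOutcome_le (spinEigenspace_xDirection_le _) (spinEigenspace_xDirection_le _)) l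
    (hB.verifies_joint l xDirection xDirection)
  set p : Spin := !₂[(1 : ℂ), ((α xDirection l : ℤ) : ℂ)] with hp
  set q : Spin := !₂[(1 : ℂ), ((β xDirection l : ℤ) : ℂ)] with hq
  have hpi : ∀ k, p k ≠ 0 := by intro k; fin_cases k <;> simp [hp]
  have hqi : ∀ k, q k ≠ 0 := by intro k; fin_cases k <;> simp [hq]
  obtain ⟨k, hk⟩ := exists_ne i
  -- A witness that the rays differ: `f` is orthogonal to the `z, z` product vector but not to `p ⊗
  -- q`, whose factors have no zero coordinate.
  set f : SpinPair := EuclideanSpace.single k 1 ⊗ₜ[ℂ] EuclideanSpace.single j 1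
  have hf : inner ℂ f (p ⊗ₜ[ℂ] q : SpinPair) ≠ 0 := by
    simpa [f, TensorProduct.inner_tmul, EuclideanSpace.inner_single_left] using ⟨hpi k, hqi j⟩
  have hij : (EuclideanSpace.single i 1 ⊗ₜ[ℂ] EuclideanSpace.single j 1 : SpinPair) ≠ 0 := by
    intro h
    have := congrArg
      (inner ℂ (EuclideanSpace.single i 1 ⊗ₜ[ℂ] EuclideanSpace.single j 1 : SpinPair)) h
    simp [TensorProduct.inner_tmul] at this
  have hpq : (p ⊗ₜ[ℂ] q : SpinPair) ≠ 0 := fun h => hf (by rw [h, inner_zero_right])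
  have heq := hG.subsingleton_isVectorRay three_le_rank_spinPair l
    ⟨h1, isVectorRay_iff_exists_finiteSpan.2 ⟨_, hij, rfl⟩⟩
    ⟨h2, isVectorRay_iff_exists_finiteSpan.2 ⟨_, hpq, rfl⟩⟩
  have hmem : (p ⊗ₜ[ℂ] q : SpinPair) ∈ finiteSpan ℂ {(p ⊗ₜ[ℂ] q : SpinPair)} :=
    mem_finiteSpan_singleton.2 ⟨1, one_smul _ _⟩
  rw [← heq] at hmem
  obtain ⟨c, hc⟩ := mem_finiteSpan_singleton.1 hmem
  refine hf ?_
  rw [← hc, inner_smul_right, TensorProduct.inner_tmul]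
  simp [EuclideanSpace.inner_single_left, hk]

theorem mainTheorem3 :
    (∀ (𝕜 : Type*) (H : Type*) [RCLike 𝕜] [NormedAddCommGroup H] [InnerProductSpace 𝕜 H]
      [CompleteSpace H], 3 ≤ Module.rank 𝕜 H →
      ∀ (A : Type*) (G : MeasurementGraph (HilbertLattice 𝕜 H) A), G.IsModel →
        (∀ a : A, {p ∈ G.properties a | IsVectorRay p}.Subsingleton) ∧
        ¬ ∃ (a : A) (p q : HilbertLattice 𝕜 H),
          IsAtom p ∧ IsAtom q ∧ p ≠ q ∧ G.Verifies a p ∧ G.Verifies a q) ∧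
    (∀ (A : Type*) (G : MeasurementGraph (HilbertLattice ℂ SpinPair) A)
      (α β : Direction → A → ℤˣ), ¬ IsBellModel G α β) := by
  refine ⟨fun 𝕜 H _ _ _ _ hH A G hG => ⟨hG.subsingleton_isVectorRay hH, ?_⟩,
    fun A G α β => not_isBellModel G α β⟩
  rintro ⟨a, p, q, hp, hq, hpq, hap, haq⟩
  exact hpq (hG.subsingleton_isVectorRay hH a ⟨hap, isVectorRay_of_isAtom hp⟩
    ⟨haq, isVectorRay_of_isAtom hq⟩)
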